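/- Let $k$ be a field of characteristic zero and let $\mathcal H=\bigoplus_{n\ge 0}\mathcal H_n$ be a connected graded Hopf algebra over $k$: $\mathcal H_0=k\cdot 1$, each $\mathcal H_n$ is finite-dimensional, $\mathcal H_i\mathcal H_j\subseteq\mathcal H_{i+j}$, $\Delta(\mathcal H_n)\subseteq\bigoplus_{j=0}^n\mathcal H_j\otimes\mathcal H_{n-j}$, and the counit vanishes in positive degree. Suppose that, as an algebra, $\mathcal H$ is a polynomial algebra on a (finite or infinite) family of homogeneous generators; let $\mathcal B$ be its basis of monomials in the generators and $\mathcal B_n=\mathcal B\cap\mathcal H_n$. The length $l(b)$ of a monomial $b=c_1c_2\cdots c_l$ (with $c_i$ generators, possibly repeated) is $l(b)=l$. For an integer $a\ge 1$ let $\Psi^a=m^{[a]}\Delta^{[a]}$ be the $a$-fold coproduct followed by the $a$-fold product, and write $b\to b'$ (for $b,b'\in\mathcal B$) if $b'$ occurs with nonzero coefficient in $\Psi^a(b)$ for some $a\ge 1$. Let $\bar\Delta(x)=\Delta(x)-1\otimes x-x\otimes 1$, let $\bar\Delta^{[1]}=\iota$ be the identity and $\bar\Delta^{[a]}=(\iota\otimes\cdots\otimes\iota\otimes\bar\Delta)\bar\Delta^{[a-1]}$,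 and let $e$ be the first Eulerian idempotent, $$e(x)=\sum_{a\ge 1}\frac{(-1)^{a-1}}{a}\,m^{[a]}\bar\Delta^{[a]}(x)$$ for $x$ of positive degree (a finite sum), with $e=0$ on $\mathcal H_0$. For $b=c_1c_2\cdots c_l\in\mathcal B$ set $$g_b:=e(c_1)e(c_2)\cdots e(c_l),$$ and write $g_b(b')$ for the coefficient of $b'$ in $g_b$ with respect to the basis $\mathcal B$. Then for every $a\ge 1$ and every $b\in\mathcal B$ of length $l$, $g_b$ is an eigenvector of $\Psi^a$ of eigenvalue $a^l$, and $$g_b=b+\sum_{\substack{b\to b'\\ b'\ne b}}g_b(b')\,b'=b+\sum_{l(b')>l(b)}g_b(b')\,b'.$$ Moreover, for every $n\ge 0$ and every $a\ge 1$, $\Psi^a$ maps $\mathcal H_n$ to itself and $\{g_b\mid b\in\mathcal B_n\}$ is a basis of $\mathcal H_n$ consisting of eigenvectors of $\Psi^a$; and for every $a\ge 2$ and $l\ge 0$, the multiplicity of the eigenvalue $a^l$ of $\Psi^a$ on $\mathcal H_n$ (the dimension of the $a^l$-eigenspace, read as $0$ if $a^l$ is not an eigenvalue) is the coefficient of $x^ny^l$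 in $\prod_{i\ge 1}(1-yx^i)^{-d_i}$, where $d_i$ is the number of generators of degree $i$. -/

import Mathlib

open scoped TensorProduct

noncomputable section

namespace HopfPower

section Bialgebra

variable {k H : Type*} [Field k] [Ring H] [Bialgebra k H]

variable (k H) in
/-- The identification of `H` with its first tensor power. -/
def tensorOne : H ≃ₗ[k] ⨂[k]^1 H :=
  (PiTensorProduct.subsingletonEquiv (R := k) (s := fun _ : Fin 1 => H) 0).symm

variable (k H) in
/-- The identification of `H ⊗ H` with the second tensor power of `H`. -/
def tensorTwo : H ⊗[k] H ≃ₗ[k] ⨂[k]^2 H :=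
  (TensorProduct.congr (tensorOne k H) (tensorOne k H)).trans TensorPower.mulEquiv

/-- The map `ι ⊗ ⋯ ⊗ ι ⊗ D : H^{⊗(n+1)} → H^{⊗(n+2)}`, which applies `D : H → H ⊗ H` to the last
tensor factor. -/
def applyLast (D : H →ₗ[k] H ⊗[k] H) (n : ℕ) : ⨂[k]^(n + 1) H →ₗ[k] ⨂[k]^(n + 2) H :=
  (TensorPower.mulEquiv (R := k) (M := H) (n := n) (m := 2)).toLinearMap ∘ₗ
    LinearMap.lTensor (⨂[k]^n H)
      ((tensorTwo k H).toLinearMap ∘ₗ D ∘ₗ (tensorOne k H).symm.toLinearMap) ∘ₗ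
    (TensorPower.mulEquiv (R := k) (M := H) (n := n) (m := 1)).symm.toLinearMap

/-- The iterates `D^{[a]} : H → H^{⊗a}` of `D : H → H ⊗ H`, for `a ≥ 1`: `D^{[1]}` is the identity
and `D^{[a]} = (ι ⊗ ⋯ ⊗ ι ⊗ D) D^{[a-1]}`. The value at `a = 0` is a dummy and is never used. -/
def iterated (D : H →ₗ[k] H ⊗[k] H) : (a : ℕ) → H →ₗ[k] ⨂[k]^a H
  | 0 => 0
  | 1 => (tensorOne k H).toLinearMap
  | n + 2 => applyLast D n ∘ₗ iterated D (n + 1)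

variable (k H) in
/-- The `a`-fold product `m^{[a]} : H^{⊗a} → H`. -/
def mulPow (a : ℕ) : ⨂[k]^a H →ₗ[k] H :=
  PiTensorProduct.lift (MultilinearMap.mkPiAlgebraFin k a H)

variable (k H) in
/-- The `a`-th Hopf power map `Ψ^a = m^{[a]} Δ^{[a]}`, for `a ≥ 1`. -/
def hopfPower (a : ℕ) : Module.End k H :=
  mulPow k H a ∘ₗ iterated Coalgebra.comul a

variable (k H) in
/-- The reduced coproduct `x ↦ Δ(x) - 1 ⊗ x - x ⊗ 1`. -/
def reducedComul : H →ₗ[k] H ⊗[k] H :=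
  Coalgebra.comul - TensorProduct.mk k H H 1 - (TensorProduct.mk k H H).flip 1

variable (k) in
/-- The (first) Eulerian idempotent. On elements of positive degree (which the counit kills) it is
`e(x) = ∑_{a ≥ 1} (-1)^(a-1) / a • m^{[a]} Δbar^{[a]} (x)`, with `Δbar` the reduced coproduct; it is
zero on scalars. In a connected graded Hopf algebra the sum has finitely many nonzero terms. -/
def eulerian (x : H) : H :=
  ∑ᶠ (a : ℕ) (_ : 1 ≤ a), ((-1 : k) ^ (a - 1) / (a : k)) •
    mulPow k H a (iterated (reducedComul k H) a
      (x - algebraMap k H (Coalgebra.counit (R := k) x)))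

/-- `𝒜` makes the bialgebra (or Hopf algebra) `H`, already graded as an algebra, a connected graded
one with finite-dimensional homogeneous components. -/
structure IsConnectedGraded (𝒜 : ℕ → Submodule k H) [GradedAlgebra 𝒜] : Prop where
  finiteDimensional : ∀ n, FiniteDimensional k (𝒜 n)
  connected : 𝒜 0 = Submodule.span k {1}
  comul_mem : ∀ n, ∀ x ∈ 𝒜 n, Coalgebra.comul (R := k) x ∈
    ⨆ p ∈ Finset.HasAntidiagonal.antidiagonal n, LinearMap.range (TensorProduct.mapIncl (𝒜 p.1) (𝒜 p.2))
  counit_eq_zero : ∀ n, 0 < n → ∀ x ∈ 𝒜 n, Coalgebra.counit (R := k) x = 0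

end Bialgebra

section Polynomial

variable {k H σ : Type*} [Field k] [CommRing H] [HopfAlgebra k H]

/-- The generator `c_i` of the polynomial algebra `H`. -/
def gen (φ : MvPolynomial σ k ≃ₐ[k] H) (i : σ) : H := φ (MvPolynomial.X i)

/-- The basis of monomials in the generators, indexed by exponent vectors. -/
def monomialBasis (φ : MvPolynomial σ k ≃ₐ[k] H) : Module.Basis (σ →₀ ℕ) k H :=
  (MvPolynomial.basisMonomials σ k).map φ.toLinearEquiv

/-- The number of generators, counted with multiplicity, in the monomial with exponents `b`. -/
def length (b : σ →₀ ℕ) : ℕ := b.sum fun _ m => m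

/-- The relation `b → b'`: the monomial `b'` occurs in `Ψ^a(b)` for some `a ≥ 1`. -/
def Reaches (φ : MvPolynomial σ k ≃ₐ[k] H) (b b' : σ →₀ ℕ) : Prop :=
  ∃ a : ℕ, 1 ≤ a ∧ (monomialBasis φ).repr (hopfPower k H a (monomialBasis φ b)) b' ≠ 0

/-- `g_b = e(c_1) ⋯ e(c_l)` for the monomial `b = c_1 ⋯ c_l`. -/
def g (φ : MvPolynomial σ k ≃ₐ[k] H) (b : σ →₀ ℕ) : H :=
  b.prod fun i m => eulerian k (gen φ i) ^ m

/-- The monomials of degree `n`. -/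
def monomialsOfDegree (φ : MvPolynomial σ k ≃ₐ[k] H) (𝒜 : ℕ → Submodule k H) (n : ℕ) :
    Set (σ →₀ ℕ) :=
  {b | monomialBasis φ b ∈ 𝒜 n}

/-- The number of generators of degree `i`. -/
def numGen (φ : MvPolynomial σ k ≃ₐ[k] H) (𝒜 : ℕ → Submodule k H) (i : ℕ) : ℕ :=
  Set.ncard {s : σ | gen φ s ∈ 𝒜 i}

end Polynomial

/-- The power series `(1 - y x^i)^(-d)` in `ℤ⟦x, y⟧`, where `x = X 0` and `y = X 1`. -/
def eulerFactor (i d : ℕ) : MvPowerSeries (Fin 2) ℤ :=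
  MvPowerSeries.invOfUnit (1 - MvPowerSeries.X 1 * MvPowerSeries.X 0 ^ i) 1 ^ d

end HopfPower

end

open HopfPower
open scoped MvPowerSeries.WithPiTopology

/-!
The maps `Ψ^a` are the convolution powers of the identity of `H`: this is how `m^{[a]}` undoes the
iterated coproduct one factor at a time (`mulPow_comp_iterated`, `toConv_hopfPower`). Put
`J = ι - ηε`, where `ηε` is the unit for convolution. In positive degree `m^{[a]} Δbar^{[a]}` is the
convolution power `J^{*a}`, because `Δbar J = (J ⊗ J) Δ` (`mulPow_iterated_reducedComul`), and
`J^{*a}` vanishes in degrees below `a`. By the binomial theorem `Ψ^a(x) = ∑_j C(a, j) J^{*j}(x)`, so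
for `x` homogeneous of positive degree `Ψ^a(x)` is a polynomial in `a` with coefficients in `H`. Its
constant term is zero and its linear coefficient is `e(x)` (`exists_powerPolynomial`).

As `H` is commutative, `Ψ^a` is an algebra endomorphism and `Ψ^a Ψ^b = Ψ^{ab}`. Comparing the
coefficients of `b` in this polynomial identity gives `Ψ^a(e(x)) = a e(x)`
(`hopfPower_eulerian`), whence `Ψ^a(g_b) = a^{l(b)} g_b` by multiplicativity. Likewise, `Ψ^a(b)` is
a polynomial in `a` whose coefficient of `a^{l(b)}` is `g_b`; if `b'` occurs in no `Ψ^a(b)`, it does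
not occur in that coefficient (`reaches_of_repr_g_ne_zero`).

For `j ≥ 2`, `J^{*j}` takes values in the square of the augmentation ideal, so `e(c)` is `c` plus
longer monomials, and `g_b` is `b` plus longer monomials (`g_sub_mem`). Hence the `g_b` are linearly
independent, and counting dimensions makes those of degree `n` a basis of `H_n`. The multiplicity
of `a^l` on `H_n` is therefore the number of monomials of degree `n` and length `l`. Expanding the
geometric series `∏_t (1 - y x^{deg t})⁻¹` over finite sets of generators `t` identifies this
number with the coefficient of `x^n y^l` in the product (`prod_invOfUnit_eq_countSeries`,
`hasProd_eulerFactor`).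
-/

noncomputable section

namespace HopfPower

/-! ### Iterated coproducts and products -/

section Bialgebra

open TensorPower PiTensorProduct

variable {k H : Type*} [Field k] [Ring H] [Bialgebra k H]

/-- The operator `g ↦ m ∘ (ι ⊗ g) ∘ D` on linear endomorphisms. For `D` the coproduct it is left
convolution by the identity. -/
def foldLast (D : H →ₗ[k] H ⊗[k] H) (g : H →ₗ[k] H) : H →ₗ[k] H :=
  LinearMap.mul' k H ∘ₗ LinearMap.lTensor H g ∘ₗ D

/-- The map `x₁ ⊗ ⋯ ⊗ xₙ ⊗ y ↦ x₁ ⋯ xₙ g(y)`. -/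
def mulLast (n : ℕ) (g : H →ₗ[k] H) : ⨂[k]^(n + 1) H →ₗ[k] H :=
  LinearMap.mul' k H ∘ₗ
    TensorProduct.map (mulPow k H n) (g ∘ₗ (tensorOne k H).symm.toLinearMap) ∘ₗ
      (mulEquiv (R := k) (M := H) (n := n) (m := 1)).symm.toLinearMap

lemma tensorOne_apply (x : H) : tensorOne k H x = tprod k (fun _ => x) :=
  PiTensorProduct.subsingletonEquiv_symm_apply' _ _

lemma mulEquiv_tprod {n m : ℕ} (v : Fin n → H) (w : Fin m → H) :
    mulEquiv (tprod k v ⊗ₜ[k] tprod k w) = tprod k (Fin.append v w) :=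
  tprod_mul_tprod k v w

lemma mulPow_tprod (n : ℕ) (v : Fin n → H) :
    mulPow k H n (tprod k v) = (List.ofFn v).prod := by
  simp [mulPow]

lemma mulLast_apply (n : ℕ) (g : H →ₗ[k] H) (v : Fin n → H) (y : H) :
    mulLast n g (mulEquiv (tprod k v ⊗ₜ[k] tensorOne k H y)) = (List.ofFn v).prod * g y := by
  simp only [mulLast, LinearMap.comp_apply, LinearEquiv.coe_coe, LinearEquiv.symm_apply_apply]
  simp [mulPow_tprod]

/-- Linear maps on a tensor power are determined by their values on pure tensors with the last
factor split off. -/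
lemma tensorPower_succ_hom_ext {n : ℕ} {N : Type*} [AddCommGroup N] [Module k N]
    {f g : ⨂[k]^(n + 1) H →ₗ[k] N}
    (h : ∀ (v : Fin n → H) (y : H), f (mulEquiv (tprod k v ⊗ₜ[k] tensorOne k H y)) =
      g (mulEquiv (tprod k v ⊗ₜ[k] tensorOne k H y))) : f = g := by
  have hs : Function.Surjective
      (mulEquiv (R := k) (M := H) (n := n) (m := 1)).toLinearMap := mulEquiv.surjective
  refine (LinearMap.cancel_right hs).1 (TensorProduct.ext ?_)
  refine PiTensorProduct.ext (MultilinearMap.ext fun v => ?_)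
  ext y
  have hy : PiTensorProduct.tprod k y = tensorOne k H (y 0) := by
    rw [tensorOne_apply]
    congr 1
    ext i
    rw [Subsingleton.elim i 0]
  change f (mulEquiv (PiTensorProduct.tprod k v ⊗ₜ[k] PiTensorProduct.tprod k y)) =
    g (mulEquiv (PiTensorProduct.tprod k v ⊗ₜ[k] PiTensorProduct.tprod k y))
  rw [hy]
  exact h v (y 0)

lemma mulLast_zero (g : H →ₗ[k] H) : mulLast 0 g ∘ₗ (tensorOne k H).toLinearMap = g := by
  ext x
  have : mulEquiv (tprod k (Fin.elim0 : Fin 0 → H) ⊗ₜ[k] tensorOne k H x) = tensorOne k H x := by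
    rw [tensorOne_apply, mulEquiv_tprod]
    congr 1
    ext i
    simp [Fin.append, Fin.addCases]
  rw [LinearMap.comp_apply, LinearEquiv.coe_coe, ← this, mulLast_apply]
  simp

lemma mulLast_id (n : ℕ) : mulLast n (LinearMap.id : H →ₗ[k] H) = mulPow k H (n + 1) := by
  refine tensorPower_succ_hom_ext fun v y => ?_
  rw [mulLast_apply, tensorOne_apply, mulEquiv_tprod, mulPow_tprod,
    List.ofFn_fin_append]
  simp

/-- Applying `D` to the last factor before multiplying amounts to replacing `g` by
`foldLast D g`. -/
lemma mulLast_succ_comp_applyLast (D : H →ₗ[k] H ⊗[k] H) (n : ℕ) (g : H →ₗ[k] H) :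
    mulLast (n + 1) g ∘ₗ applyLast D n = mulLast n (foldLast D g) := by
  have key : ∀ (v : Fin n → H) (t : H ⊗[k] H),
      mulLast (n + 1) g (mulEquiv (n := n) (m := 2) (PiTensorProduct.tprod k v ⊗ₜ[k]
        tensorTwo k H t)) =
        (List.ofFn v).prod * LinearMap.mul' k H (LinearMap.lTensor H g t) := by
    intro v t
    induction t with
    | zero => simp
    | add a b ha hb => simp only [map_add, TensorProduct.tmul_add, ha, hb, mul_add]
    | tmul y z =>
      have : mulEquiv (n := n) (m := 2) (PiTensorProduct.tprod k v ⊗ₜ[k]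
            tensorTwo k H (y ⊗ₜ[k] z)) =
          mulEquiv (n := n + 1) (m := 1)
            (PiTensorProduct.tprod k (Fin.append v (fun _ : Fin 1 => y)) ⊗ₜ[k]
              tensorOne k H z) := by
        simp only [tensorTwo, LinearEquiv.trans_apply, TensorProduct.congr_tmul, tensorOne_apply]
        rw [mulEquiv_tprod, mulEquiv_tprod, mulEquiv_tprod, Fin.append_assoc]
        rfl
      rw [this, mulLast_apply, List.ofFn_fin_append]
      simp [_root_.mul_assoc]
  refine tensorPower_succ_hom_ext fun v y => ?_
  rw [mulLast_apply, LinearMap.comp_apply, applyLast]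
  simp only [LinearMap.comp_apply, LinearEquiv.coe_coe, LinearEquiv.symm_apply_apply,
    LinearMap.lTensor_tmul]
  rw [key]
  rfl

lemma mulPow_comp_iterated (D : H →ₗ[k] H ⊗[k] H) (n : ℕ) :
    mulPow k H (n + 1) ∘ₗ iterated D (n + 1) = (foldLast D)^[n] LinearMap.id := by
  have key : ∀ g : H →ₗ[k] H, mulLast n g ∘ₗ iterated D (n + 1) = (foldLast D)^[n] g := by
    induction n with
    | zero => exact mulLast_zero
    | succ n ih =>
      intro g
      rw [iterated, ← LinearMap.comp_assoc, mulLast_succ_comp_applyLast, ih,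
        Function.iterate_succ_apply]
  rw [← mulLast_id, key]

end Bialgebra

/-! ### Hopf powers in the convolution algebra -/

section Convolution

open WithConv

variable {k H : Type*} [Field k] [Ring H] [Bialgebra k H]

variable (k H) in
/-- The projection `x ↦ x - ε(x) 1` of `H` onto the kernel of the counit. -/
def augProj : H →ₗ[k] H := LinearMap.id - Algebra.linearMap k H ∘ₗ Coalgebra.counit

variable (k H) in
/-- The `j`-th convolution power of the projection of `H` onto the kernel of the counit. -/
def augPow (j : ℕ) : H →ₗ[k] H := (toConv (augProj k H) ^ j).ofConv

lemma augProj_apply (x : H) :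
    augProj k H x = x - algebraMap k H (Coalgebra.counit (R := k) x) := rfl

lemma augProj_one : augProj k H 1 = 0 := by simp [augProj_apply]

lemma counit_augProj (x : H) : Coalgebra.counit (R := k) (augProj k H x) = 0 := by
  simp [augProj_apply]

lemma augPow_zero_apply (x : H) :
    augPow k H 0 x = algebraMap k H (Coalgebra.counit (R := k) x) := rfl

lemma augPow_one : augPow k H 1 = augProj k H := by simp [augPow]

lemma toConv_hopfPower (n : ℕ) :
    toConv (hopfPower k H (n + 1)) = toConv (LinearMap.id : H →ₗ[k] H) ^ (n + 1) := by
  rw [hopfPower, mulPow_comp_iterated]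
  induction n with
  | zero => simp
  | succ n ih =>
    rw [pow_succ', ← ih, Function.iterate_succ_apply']
    rfl

lemma toConv_augProj :
    toConv (augProj k H) = toConv (LinearMap.id : H →ₗ[k] H) - 1 := rfl

/-- `Ψ^a` expanded by the binomial theorem in the convolution algebra. -/
lemma hopfPower_apply_eq_sum (n : ℕ) (x : H) :
    hopfPower k H (n + 1) x =
      ∑ j ∈ Finset.range (n + 2), ((n + 1).choose j : k) • augPow k H j x := by
  have h := toConv_hopfPower (k := k) (H := H) n
  have h1 : toConv (LinearMap.id : H →ₗ[k] H) = toConv (augProj k H) + 1 := by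
    rw [toConv_augProj, sub_add_cancel]
  rw [h1, (Commute.one_right _).add_pow] at h
  have h2 : hopfPower k H (n + 1) = ∑ j ∈ Finset.range (n + 2),
      ((n + 1).choose j : k) • augPow k H j := by
    apply toConv_injective
    rw [h]
    simp only [toConv_sum, augPow, one_pow, mul_one]
    refine Finset.sum_congr rfl fun j _ => ?_
    rw [← nsmul_eq_mul', Nat.cast_smul_eq_nsmul]
    rfl
  rw [h2]
  simp [LinearMap.sum_apply]

/-- `Δbar J = (J ⊗ J) Δ`, where `J` is the projection onto the kernel of the counit. -/
lemma reducedComul_comp_augProj :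
    reducedComul k H ∘ₗ augProj k H =
      TensorProduct.map (augProj k H) (augProj k H) ∘ₗ Coalgebra.comul := by
  have key : ∀ t : H ⊗[k] H, TensorProduct.map (augProj k H) (augProj k H) t =
      t - 1 ⊗ₜ[k] TensorProduct.lid k H (LinearMap.rTensor H Coalgebra.counit t) -
        TensorProduct.rid k H (LinearMap.lTensor H Coalgebra.counit t) ⊗ₜ[k] 1 +
        Coalgebra.counit (R := k)
          (TensorProduct.lid k H (LinearMap.rTensor H Coalgebra.counit t)) • 1 ⊗ₜ[k] 1 := by
    intro t
    induction t with
    | zero => simp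
    | add a b ha hb =>
      simp only [map_add, ha, hb, TensorProduct.tmul_add, TensorProduct.add_tmul, add_smul]
      abel
    | tmul y z =>
      simp only [TensorProduct.map_tmul, augProj_apply, TensorProduct.sub_tmul,
        TensorProduct.tmul_sub, Algebra.algebraMap_eq_smul_one, LinearMap.rTensor_tmul,
        LinearMap.lTensor_tmul, TensorProduct.lid_tmul, TensorProduct.rid_tmul,
        TensorProduct.tmul_smul, ← TensorProduct.smul_tmul', map_smul, smul_eq_mul]
      module
  ext x
  rw [LinearMap.comp_apply, LinearMap.comp_apply, key, Coalgebra.rTensor_counit_comul,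
    Coalgebra.lTensor_counit_comul]
  simp only [reducedComul, augProj_apply, LinearMap.sub_apply, map_sub, LinearMap.flip_apply,
    TensorProduct.mk_apply, TensorProduct.lid_tmul, TensorProduct.rid_tmul, one_smul,
    Algebra.algebraMap_eq_smul_one, map_smul, Bialgebra.comul_one, Algebra.TensorProduct.one_def]
  module

/-- On the kernel of the counit, the `a`-fold reduced coproduct followed by the `a`-fold product
is the `a`-th convolution power of the projection onto that kernel. -/
lemma mulPow_iterated_reducedComul (n : ℕ) (x : H) :
    mulPow k H (n + 1) (iterated (reducedComul k H) (n + 1) (augProj k H x)) =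
      augPow k H (n + 1) x := by
  have h : (foldLast (reducedComul k H))^[n] LinearMap.id ∘ₗ augProj k H =
      augPow k H (n + 1) := by
    induction n with
    | zero => rw [augPow_one]; rfl
    | succ n ih =>
      rw [Function.iterate_succ_apply', augPow, pow_succ', LinearMap.convMul_def]
      change _ = LinearMap.mul' k H ∘ₗ
        TensorProduct.map (augProj k H) (augPow k H (n + 1)) ∘ₗ Coalgebra.comul
      rw [← ih, foldLast, LinearMap.comp_assoc, LinearMap.comp_assoc, reducedComul_comp_augProj,
        ← LinearMap.lTensor_comp_map]
      rfl
  rw [← h, ← mulPow_comp_iterated]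
  rfl

end Convolution

/-! ### Nilpotence in each degree -/

section Graded

open WithConv

variable {k H : Type*} [Field k] [Ring H] [Bialgebra k H] {𝒜 : ℕ → Submodule k H}
  [GradedAlgebra 𝒜]

/-- As `Δ` respects the grading, the value of a convolution product on degree `n` is controlled by
the values of the factors on homogeneous elements of complementary degrees. -/
lemma IsConnectedGraded.convMul_mem (h𝒜 : IsConnectedGraded 𝒜) {n : ℕ} {x : H} (hx : x ∈ 𝒜 n)
    (f g : WithConv (H →ₗ[k] H)) (S : Submodule k H)
    (h : ∀ i j, i + j = n → ∀ y ∈ 𝒜 i, ∀ z ∈ 𝒜 j, f.ofConv y * g.ofConv z ∈ S) :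
    (f * g).ofConv x ∈ S := by
  have hle : (⨆ p ∈ Finset.HasAntidiagonal.antidiagonal n,
      LinearMap.range (TensorProduct.mapIncl (𝒜 p.1) (𝒜 p.2))) ≤
      S.comap (LinearMap.mul' k H ∘ₗ TensorProduct.map f.ofConv g.ofConv) := by
    refine iSup₂_le fun p hp => ?_
    rintro _ ⟨t, rfl⟩
    induction t with
    | zero => simp
    | add a b ha hb => rw [map_add]; exact add_mem ha hb
    | tmul y z =>
      simpa [TensorProduct.mapIncl] using
        h p.1 p.2 (Finset.HasAntidiagonal.mem_antidiagonal.1 hp) y y.2 z z.2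
  exact hle (h𝒜.comul_mem n x hx)

lemma IsConnectedGraded.augProj_mem (h𝒜 : IsConnectedGraded 𝒜) {n : ℕ} {x : H} (hx : x ∈ 𝒜 n) :
    augProj k H x ∈ 𝒜 n := by
  rw [augProj_apply]
  rcases Nat.eq_zero_or_pos n with rfl | hn
  · exact sub_mem hx (SetLike.algebraMap_mem_graded 𝒜 _)
  · simpa [h𝒜.counit_eq_zero n hn x hx] using hx

lemma IsConnectedGraded.augPow_mem (h𝒜 : IsConnectedGraded 𝒜) (j : ℕ) {n : ℕ} {x : H}
    (hx : x ∈ 𝒜 n) : augPow k H j x ∈ 𝒜 n := by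
  induction j generalizing n x with
  | zero =>
    rw [augPow_zero_apply]
    rcases Nat.eq_zero_or_pos n with rfl | hn
    · exact SetLike.algebraMap_mem_graded 𝒜 _
    · simp [h𝒜.counit_eq_zero n hn x hx]
  | succ j ih =>
    rw [augPow, pow_succ]
    refine h𝒜.convMul_mem hx _ _ _ fun i l hil y hy z hz => ?_
    rw [← hil]
    exact SetLike.mul_mem_graded (ih hy) (h𝒜.augProj_mem hz)

lemma IsConnectedGraded.augProj_eq_zero (h𝒜 : IsConnectedGraded 𝒜) {x : H} (hx : x ∈ 𝒜 0) :
    augProj k H x = 0 := by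
  rw [h𝒜.connected, Submodule.mem_span_singleton] at hx
  obtain ⟨c, rfl⟩ := hx
  rw [map_smul, augProj_one, smul_zero]

/-- Nilpotence in each degree, which makes the Eulerian idempotent a finite sum. -/
lemma IsConnectedGraded.augPow_eq_zero (h𝒜 : IsConnectedGraded 𝒜) {j n : ℕ} (hn : n < j) {x : H}
    (hx : x ∈ 𝒜 n) : augPow k H j x = 0 := by
  induction j generalizing n x with
  | zero => omega
  | succ j ih =>
    rw [augPow, pow_succ, ← Submodule.mem_bot (R := k)]
    refine h𝒜.convMul_mem hx _ _ _ fun i l hil y hy z hz => ?_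
    rw [Submodule.mem_bot]
    rcases Nat.eq_zero_or_pos l with rfl | hl
    · change _ * augProj k H z = 0
      rw [h𝒜.augProj_eq_zero hz, mul_zero]
    · change augPow k H j y * _ = 0
      rw [ih (by omega) hy, zero_mul]

/-- The binomial expansion of `Ψ^a`, with a range of summation that depends only on the degree and
not on `a`. -/
lemma IsConnectedGraded.hopfPower_apply (h𝒜 : IsConnectedGraded 𝒜) {n : ℕ} {x : H} (hx : x ∈ 𝒜 n)
    {a : ℕ} (ha : 1 ≤ a) :
    hopfPower k H a x = ∑ j ∈ Finset.range (n + 1), (a.choose j : k) • augPow k H j x := by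
  obtain ⟨a, rfl⟩ := Nat.exists_eq_add_of_le' ha
  rw [hopfPower_apply_eq_sum]
  have h1 : Finset.range (a + 2) ⊆ Finset.range (a + 2 + n) :=
    Finset.range_subset_range.2 (by omega)
  have h2 : Finset.range (n + 1) ⊆ Finset.range (a + 2 + n) :=
    Finset.range_subset_range.2 (by omega)
  rw [Finset.sum_subset h1, Finset.sum_subset h2]
  · intro j _ hj
    rw [h𝒜.augPow_eq_zero (by simpa using hj) hx, smul_zero]
  · intro j _ hj
    rw [Nat.choose_eq_zero_of_lt (by rw [Finset.mem_range] at hj; omega), Nat.cast_zero, zero_smul]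

lemma IsConnectedGraded.hopfPower_mem (h𝒜 : IsConnectedGraded 𝒜) {n : ℕ} {x : H} (hx : x ∈ 𝒜 n)
    {a : ℕ} (ha : 1 ≤ a) : hopfPower k H a x ∈ 𝒜 n := by
  rw [h𝒜.hopfPower_apply hx ha]
  exact sum_mem fun j _ => Submodule.smul_mem _ _ (h𝒜.augPow_mem j hx)

lemma IsConnectedGraded.eulerian_eq_sum (h𝒜 : IsConnectedGraded 𝒜) {n : ℕ} {x : H} (hx : x ∈ 𝒜 n) :
    eulerian k x =
      ∑ j ∈ Finset.range n, ((-1 : k) ^ j / ((j + 1 : ℕ) : k)) • augPow k H (j + 1) x := by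
  rw [eulerian]
  have h : ∀ j : ℕ, mulPow k H (j + 1) (iterated (reducedComul k H) (j + 1)
      (x - algebraMap k H (Coalgebra.counit (R := k) x))) = augPow k H (j + 1) x := fun j =>
    mulPow_iterated_reducedComul j x
  rw [finsum_cond_eq_sum_of_cond_iff
    (t := (Finset.range n).map ⟨Nat.succ, Nat.succ_injective⟩), Finset.sum_map]
  · exact Finset.sum_congr rfl fun j _ => by
      simp only [Function.Embedding.coeFn_mk, Nat.succ_eq_add_one, h, Nat.add_sub_cancel]
  · intro j hj
    cases j with
    | zero => simp
    | succ j =>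
      have : j < n := by
        by_contra! hlt
        exact hj (by rw [h, h𝒜.augPow_eq_zero (Nat.lt_succ_of_le hlt) hx, smul_zero])
      simpa using this

lemma IsConnectedGraded.eulerian_mem (h𝒜 : IsConnectedGraded 𝒜) {n : ℕ} {x : H} (hx : x ∈ 𝒜 n) :
    eulerian k x ∈ 𝒜 n := by
  rw [h𝒜.eulerian_eq_sum hx]
  exact sum_mem fun j _ => Submodule.smul_mem _ _ (h𝒜.augPow_mem _ hx)

end Graded

/-! ### Polynomiality of the Hopf powers -/

section PowerPolynomial

open Polynomial

lemma coeff_zero_descPochhammer_succ (R : Type*) [CommRing R] (n : ℕ) :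
    (descPochhammer R (n + 1)).coeff 0 = 0 := by
  rw [descPochhammer_succ_left, mul_coeff_zero, coeff_X_zero, zero_mul]

lemma coeff_one_descPochhammer_succ (R : Type*) [CommRing R] (n : ℕ) :
    (descPochhammer R (n + 1)).coeff 1 = (-1) ^ n * (n.factorial : R) := by
  induction n with
  | zero => simp
  | succ n ih =>
    rw [descPochhammer_succ_right, mul_sub, coeff_sub, coeff_mul_X,
      coeff_zero_descPochhammer_succ, ← C_eq_natCast, coeff_mul_C, ih, Nat.factorial_succ]
    push_cast
    ring

/-- A polynomial over a `k`-algebra whose values at the positive integers are all killed by a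
linear form has all its coefficients killed by that form. -/
lemma map_coeff_eq_zero_of_map_eval_eq_zero {k A : Type*} [Field k] [CharZero k] [CommRing A]
    [Algebra k A] (L : A →ₗ[k] k) (P : A[X])
    (h : ∀ a : ℕ, 1 ≤ a → L (P.eval (a : A)) = 0) (i : ℕ) : L (P.coeff i) = 0 := by
  let Q : k[X] := ∑ j ∈ P.support, monomial j (L (P.coeff j))
  have hQ : ∀ a : ℕ, Q.eval (a : k) = L (P.eval (a : A)) := by
    intro a
    rw [eval_eq_sum (p := P), Polynomial.sum, map_sum, eval_finsetSum]
    refine Finset.sum_congr rfl fun j _ => ?_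
    have : P.coeff j * (a : A) ^ j = (a : k) ^ j • P.coeff j := by
      rw [Algebra.smul_def, mul_comm]; simp
    rw [this, map_smul, eval_monomial, smul_eq_mul, mul_comm]
  have hQ0 : Q = 0 := by
    refine Polynomial.eq_zero_of_infinite_isRoot Q
      ((Set.infinite_range_of_injective (f := fun a : ℕ => ((a + 1 : ℕ) : k)) ?_).mono ?_)
    · intro a b hab
      simpa using hab
    · rintro _ ⟨a, rfl⟩
      change Q.eval _ = 0
      rw [hQ, h _ (Nat.le_add_left 1 a)]
  have hc : Q.coeff i = L (P.coeff i) := by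
    simp only [Q, finsetSum_coeff, coeff_monomial, Finset.sum_ite_eq', mem_support_iff]
    split_ifs with h0
    · rfl
    · rw [notMem_support_iff.1 h0, map_zero]
  rw [← hc, hQ0, coeff_zero]

/-- Polynomials over a domain of characteristic zero that agree at the positive integers agree. -/
lemma eq_of_eval_natCast_eq {A : Type*} [CommRing A] [IsDomain A] [CharZero A] {P Q : A[X]}
    (h : ∀ a : ℕ, 1 ≤ a → P.eval (a : A) = Q.eval (a : A)) : P = Q := by
  refine Polynomial.eq_of_infinite_eval_eq P Q
    ((Set.infinite_range_of_injective (f := fun a : ℕ => ((a + 1 : ℕ) : A)) ?_).mono ?_)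
  · intro a b hab
    simpa using hab
  · rintro _ ⟨a, rfl⟩
    exact h _ (Nat.le_add_left 1 a)

/-- For polynomials without constant term, the lowest coefficient of a monomial in them is the
monomial in their linear coefficients. -/
lemma coeff_length_finsuppProd_pow {A σ : Type*} [CommRing A] (P : σ → A[X])
    (hP : ∀ i, (P i).coeff 0 = 0) (b : σ →₀ ℕ) :
    (b.prod fun i m => P i ^ m).coeff (length b) = b.prod fun i m => (P i).coeff 1 ^ m := by
  have hX : ∀ i, P i = (P i).divX * X := fun i => by
    conv_lhs => rw [← divX_mul_X_add (P i), hP, C_0, add_zero]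
  have hprod : (b.prod fun i m => P i ^ m) = (b.prod fun i m => (P i).divX ^ m) * X ^ length b := by
    rw [length, Finsupp.sum, ← Finset.prod_pow_eq_pow_sum, Finsupp.prod, Finsupp.prod,
      ← Finset.prod_mul_distrib]
    refine Finset.prod_congr rfl fun i _ => ?_
    rw [← mul_pow, ← hX]
  rw [hprod]
  have h0 := coeff_mul_X_pow (b.prod fun i m => (P i).divX ^ m) (length b) 0
  rw [zero_add] at h0
  rw [h0, ← constantCoeff_apply, Finsupp.prod, map_prod]
  exact Finset.prod_congr rfl fun i _ => by rw [map_pow, constantCoeff_apply, coeff_divX]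

variable {k H : Type*} [Field k] [CharZero k] [CommRing H] [Bialgebra k H]
  {𝒜 : ℕ → Submodule k H} [GradedAlgebra 𝒜]

/-- For `x` homogeneous of positive degree, `Ψ^a(x)` is polynomial in `a`, without constant term
and with linear coefficient `e(x)`. -/
lemma IsConnectedGraded.exists_powerPolynomial (h𝒜 : IsConnectedGraded 𝒜) {n : ℕ} (hn : 0 < n)
    {x : H} (hx : x ∈ 𝒜 n) :
    ∃ P : H[X], (∀ a : ℕ, 1 ≤ a → P.eval (a : H) = hopfPower k H a x) ∧
      P.coeff 0 = 0 ∧ P.coeff 1 = eulerian k x := by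
  have h0 : augPow k H 0 x = 0 := by
    rw [augPow_zero_apply, h𝒜.counit_eq_zero n hn x hx, map_zero]
  refine ⟨∑ j ∈ Finset.range n, C (augPow k H (j + 1) x) *
    (C (((j + 1).factorial : k)⁻¹) * descPochhammer k (j + 1)).map (algebraMap k H), ?_, ?_, ?_⟩
  · intro a ha
    rw [h𝒜.hopfPower_apply hx ha, Finset.sum_range_succ', h0, smul_zero, add_zero,
      eval_finsetSum]
    refine Finset.sum_congr rfl fun j _ => ?_
    rw [eval_mul, eval_C, ← map_natCast (algebraMap k H) a, eval_map_algebraMap,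
      aeval_algebraMap_apply,
      coe_aeval_eq_eval, eval_mul, eval_C, descPochhammer_eval_eq_descFactorial,
      Nat.descFactorial_eq_factorial_mul_choose, Algebra.smul_def, mul_comm]
    congr 2
    have : ((j + 1).factorial : k) ≠ 0 := by exact_mod_cast Nat.factorial_ne_zero _
    push_cast
    field_simp
  · rw [finsetSum_coeff]
    refine Finset.sum_eq_zero fun j _ => ?_
    rw [coeff_C_mul, coeff_map, coeff_C_mul, coeff_zero_descPochhammer_succ]
    simp
  · rw [h𝒜.eulerian_eq_sum hx, finsetSum_coeff]
    refine Finset.sum_congr rfl fun j _ => ?_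
    rw [coeff_C_mul, coeff_map, coeff_C_mul, coeff_one_descPochhammer_succ, Algebra.smul_def,
      mul_comm]
    congr 2
    have h1 : (j.factorial : k) ≠ 0 := by exact_mod_cast Nat.factorial_ne_zero _
    have h2 : ((j + 1 : ℕ) : k) ≠ 0 := by exact_mod_cast Nat.succ_ne_zero j
    rw [Nat.factorial_succ, Nat.cast_mul]
    field_simp

end PowerPolynomial

/-! ### Hopf powers of a commutative bialgebra -/

section Commutative

open WithConv

variable {k H : Type*} [Field k] [CommRing H] [Bialgebra k H]

variable (k H) in
/-- The Hopf power map of a commutative bialgebra, as an algebra endomorphism. At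
`a = 0` it is the convolution unit, whereas `hopfPower k H 0` is zero. -/
def hopfPowerAlgHom (a : ℕ) : H →ₐ[k] H := (toConv (AlgHom.id k H) ^ a).ofConv

lemma hopfPowerAlgHom_toLinearMap {a : ℕ} (ha : 1 ≤ a) :
    (hopfPowerAlgHom k H a).toLinearMap = hopfPower k H a := by
  obtain ⟨a, rfl⟩ := Nat.exists_eq_add_of_le' ha
  apply toConv_injective
  rw [toConv_hopfPower, hopfPowerAlgHom, AlgHom.toLinearMap_convPow]
  rfl

lemma hopfPowerAlgHom_apply {a : ℕ} (ha : 1 ≤ a) (x : H) :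
    hopfPowerAlgHom k H a x = hopfPower k H a x :=
  LinearMap.congr_fun (hopfPowerAlgHom_toLinearMap ha) x

/-- An algebra endomorphism composed with the `n`-th Hopf power is its own `n`-th convolution
power. -/
lemma algHom_comp_hopfPowerAlgHom (f : H →ₐ[k] H) (n : ℕ) :
    f.comp (hopfPowerAlgHom k H n) = (toConv f ^ n).ofConv := by
  induction n with
  | zero =>
    ext x
    change f (algebraMap k H _) = algebraMap k H _
    rw [AlgHom.commutes]
  | succ n ih =>
    rw [hopfPowerAlgHom, pow_succ, AlgHom.comp_convMul_distrib]
    change (toConv (f.comp (hopfPowerAlgHom k H n)) * toConv f).ofConv = _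
    rw [ih, pow_succ]

/-- In a commutative bialgebra `Ψ^a Ψ^b = Ψ^{ab}`. -/
lemma hopfPower_hopfPower {a b : ℕ} (ha : 1 ≤ a) (hb : 1 ≤ b) (x : H) :
    hopfPower k H a (hopfPower k H b x) = hopfPower k H (a * b) x := by
  rw [← hopfPowerAlgHom_apply ha, ← hopfPowerAlgHom_apply hb,
    ← hopfPowerAlgHom_apply (Nat.mul_pos ha hb)]
  have := algHom_comp_hopfPowerAlgHom (hopfPowerAlgHom k H a) b
  rw [hopfPowerAlgHom, toConv_ofConv, ← pow_mul] at this
  exact DFunLike.congr_fun this x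

variable {𝒜 : ℕ → Submodule k H} [GradedAlgebra 𝒜]

open Polynomial in
/-- The Eulerian idempotent takes values in the `a`-eigenspace of `Ψ^a`: comparing the linear
coefficients in `Ψ^a (Ψ^b x) = Ψ^{ab} x`, a polynomial identity in `b`. -/
lemma IsConnectedGraded.hopfPower_eulerian [CharZero k] [IsDomain H] (h𝒜 : IsConnectedGraded 𝒜)
    {n : ℕ} (hn : 0 < n) {x : H} (hx : x ∈ 𝒜 n) {a : ℕ} (ha : 1 ≤ a) :
    hopfPower k H a (eulerian k x) = (a : k) • eulerian k x := by
  have : CharZero H := charZero_of_injective_algebraMap (algebraMap k H).injective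
  obtain ⟨P, hP, -, hP1⟩ := h𝒜.exists_powerPolynomial hn hx
  have h : P.map (hopfPowerAlgHom k H a : H →+* H) = P.comp (C (a : H) * X) := by
    refine eq_of_eval_natCast_eq fun b hb => ?_
    rw [eval_comp, eval_mul, eval_C, eval_X, ← Nat.cast_mul, hP _ (Nat.mul_pos ha hb),
      ← hopfPower_hopfPower ha hb, ← hP b hb, ← hopfPowerAlgHom_apply ha]
    simp
  have h1 := congrArg (fun Q => Q.coeff 1) h
  simp only [coeff_map, comp_C_mul_X_coeff, hP1, pow_one] at h1
  rw [← hopfPowerAlgHom_apply ha, Algebra.smul_def, map_natCast, mul_comm]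
  exact h1

/-- For `j ≥ 2` the values of `J^{*j}` are decomposable. -/
lemma augPow_mem_ker_pow_two (j : ℕ) (x : H) :
    augPow k H (j + 2) x ∈ RingHom.ker (Bialgebra.counitAlgHom k H) ^ 2 := by
  set I := RingHom.ker (Bialgebra.counitAlgHom k H)
  have hJ : ∀ y, augProj k H y ∈ I := fun y =>
    counit_augProj y
  have h1 : ∀ (j : ℕ) (y : H), augPow k H (j + 1) y ∈ I := by
    intro j y
    rw [augPow, pow_succ']
    change (toConv (augProj k H) * toConv (augProj k H) ^ j) y ∈ I
    rw [(Coalgebra.Repr.arbitrary k y).convMul_apply]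
    exact sum_mem fun i _ => Ideal.mul_mem_right _ _ (hJ _)
  rw [augPow, pow_succ' (toConv (augProj k H))]
  change (toConv (augProj k H) * toConv (augProj k H) ^ (j + 1)) x ∈ I ^ 2
  rw [(Coalgebra.Repr.arbitrary k x).convMul_apply, pow_two I]
  exact sum_mem fun i _ => Ideal.mul_mem_mul (hJ _) (h1 j _)

/-- The Eulerian idempotent is the identity modulo decomposables. -/
lemma IsConnectedGraded.eulerian_sub_mem (h𝒜 : IsConnectedGraded 𝒜) {n : ℕ} (hn : 0 < n) {x : H}
    (hx : x ∈ 𝒜 n) :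
    eulerian k x - x ∈ RingHom.ker (Bialgebra.counitAlgHom k H) ^ 2 := by
  obtain ⟨n, rfl⟩ := Nat.exists_eq_add_of_le' hn
  have h1 : augPow k H 1 x = x := by
    rw [augPow_one, augProj_apply, h𝒜.counit_eq_zero _ hn x hx, map_zero, sub_zero]
  rw [h𝒜.eulerian_eq_sum hx, Finset.sum_range_succ', h1]
  simp only [pow_zero, zero_add, Nat.cast_one, div_one, one_smul, add_sub_cancel_right]
  refine sum_mem fun j _ => ?_
  rw [Algebra.smul_def]
  exact Ideal.mul_mem_left _ _ (augPow_mem_ker_pow_two j x)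

end Commutative

/-! ### Products of Eulerian elements and the length filtration -/

section Generators

open Polynomial

variable {k H σ : Type*} [Field k] [CommRing H] [HopfAlgebra k H]

lemma monomialBasis_apply (φ : MvPolynomial σ k ≃ₐ[k] H) (b : σ →₀ ℕ) :
    monomialBasis φ b = b.prod fun i m => gen φ i ^ m := by
  rw [monomialBasis, Module.Basis.map_apply, MvPolynomial.coe_basisMonomials]
  change φ (MvPolynomial.monomial b 1) = _
  rw [MvPolynomial.monomial_eq, map_one, one_mul]
  exact (map_finsuppProd φ b _).trans (Finsupp.prod_congr fun i _ => map_pow φ _ _)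

lemma monomialBasis_repr (φ : MvPolynomial σ k ≃ₐ[k] H) (x : H) (b : σ →₀ ℕ) :
    (monomialBasis φ).repr x b = MvPolynomial.coeff b (φ.symm x) := rfl

/-- The ideal of `H` spanned by the generators. Its `n`-th power consists of the elements all of
whose monomials have length at least `n`. -/
def genIdeal (φ : MvPolynomial σ k ≃ₐ[k] H) : Ideal H :=
  (MvPolynomial.idealOfVars σ k).comap φ.symm

lemma repr_eq_zero_of_mem_pow (φ : MvPolynomial σ k ≃ₐ[k] H) {n : ℕ} {x : H}
    (hx : x ∈ genIdeal φ ^ n) {b : σ →₀ ℕ} (hb : length b < n) :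
    (monomialBasis φ).repr x b = 0 := by
  have h : φ.symm x ∈ MvPolynomial.idealOfVars σ k ^ n := Ideal.le_comap_pow _ n hx
  rw [MvPolynomial.mem_pow_idealOfVars_iff] at h
  rw [monomialBasis_repr]
  by_contra h0
  exact absurd (h b (MvPolynomial.mem_support_iff.2 h0)) (not_le.2 hb)

lemma gen_mem_genIdeal (φ : MvPolynomial σ k ≃ₐ[k] H) (i : σ) :
    gen φ i ∈ genIdeal φ := by
  simpa [genIdeal, gen] using Ideal.subset_span (Set.mem_range_self i)

lemma ker_counit_le_genIdeal (φ : MvPolynomial σ k ≃ₐ[k] H)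
    (h : ∀ i, Coalgebra.counit (R := k) (gen φ i) = 0) :
    RingHom.ker (Bialgebra.counitAlgHom k H) ≤ genIdeal φ := by
  intro x hx
  have hc : (Bialgebra.counitAlgHom k H).comp (φ : MvPolynomial σ k →ₐ[k] H) =
      MvPolynomial.aeval (0 : σ → k) := by
    ext i
    simpa [gen] using h i
  have h0 : MvPolynomial.constantCoeff (φ.symm x) = 0 := by
    have h1 := DFunLike.congr_fun hc (φ.symm x)
    rw [MvPolynomial.aeval_zero, AlgHom.comp_apply] at h1
    have h2 : Bialgebra.counitAlgHom k H (φ (φ.symm x)) = 0 := by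
      rw [AlgEquiv.apply_symm_apply]; exact hx
    exact h1.symm.trans h2
  change φ.symm x ∈ MvPolynomial.idealOfVars σ k
  rw [← pow_one (MvPolynomial.idealOfVars σ k), MvPolynomial.mem_pow_idealOfVars_iff]
  intro b hb
  rw [Nat.one_le_iff_ne_zero, Ne, Finsupp.degree_eq_zero_iff]
  rintro rfl
  exact MvPolynomial.mem_support_iff.1 hb h0

/-- If `y i ≡ x i` modulo `I²`, with `x i ∈ I`, then the monomials with exponents `b` in the `y i`
and the `x i` are congruent modulo `I ^ (length b + 1)`. -/
lemma finsuppProd_sub_mem_pow {A : Type*} [CommRing A] {I : Ideal A} {x y : σ → A}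
    (hx : ∀ i, x i ∈ I) (hxy : ∀ i, y i - x i ∈ I ^ 2) (b : σ →₀ ℕ) :
    (b.prod fun i m => x i ^ m) ∈ I ^ length b ∧
      (b.prod fun i m => y i ^ m) - (b.prod fun i m => x i ^ m) ∈ I ^ (length b + 1) := by
  have step : ∀ {l l' : ℕ} {u v u' v' : A}, (u ∈ I ^ l ∧ v - u ∈ I ^ (l + 1)) →
      (u' ∈ I ^ l' ∧ v' - u' ∈ I ^ (l' + 1)) →
      (u * u' ∈ I ^ (l + l') ∧ v * v' - u * u' ∈ I ^ (l + l' + 1)) := by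
    rintro l l' u v u' v' ⟨hu, huv⟩ ⟨hu', huv'⟩
    have hv' : v' ∈ I ^ l' := by
      rw [← sub_add_cancel v' u']
      exact add_mem (Ideal.pow_le_pow_right (Nat.le_succ l') huv') hu'
    have : v * v' - u * u' = (v - u) * v' + u * (v' - u') := by ring
    refine ⟨pow_add I l l' ▸ Ideal.mul_mem_mul hu hu', ?_⟩
    rw [this]
    refine add_mem ?_ ?_
    · rw [add_right_comm, pow_add]; exact Ideal.mul_mem_mul huv hv'
    · rw [add_assoc, pow_add]; exact Ideal.mul_mem_mul hu huv'
  have hpow : ∀ i m, (x i ^ m ∈ I ^ m ∧ y i ^ m - x i ^ m ∈ I ^ (m + 1)) := by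
    intro i m
    induction m with
    | zero => simp
    | succ m ih =>
      have := step ih (l' := 1) (u' := x i) (v' := y i) ⟨by simpa using hx i, hxy i⟩
      simpa only [← pow_succ] using this
  rw [length, Finsupp.sum, Finsupp.prod, Finsupp.prod]
  induction b.support using Finset.cons_induction with
  | empty => simp
  | cons i s hi ih =>
    rw [Finset.prod_cons, Finset.prod_cons, Finset.sum_cons]
    exact step (hpow i _) ih

variable {𝒜 : ℕ → Submodule k H} [GradedAlgebra 𝒜]

/-- Generators have positive degree, since `H_0` contains only scalars. -/
lemma IsConnectedGraded.exists_pos_degree (h𝒜 : IsConnectedGraded 𝒜)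
    (φ : MvPolynomial σ k ≃ₐ[k] H) (hgen : ∀ s, SetLike.IsHomogeneousElem 𝒜 (gen φ s)) (s : σ) :
    ∃ n, 0 < n ∧ gen φ s ∈ 𝒜 n := by
  obtain ⟨n, hn⟩ := hgen s
  refine ⟨n, Nat.pos_of_ne_zero ?_, hn⟩
  rintro rfl
  rw [h𝒜.connected, Submodule.mem_span_singleton] at hn
  obtain ⟨c, hc⟩ := hn
  have h1 : φ (MvPolynomial.C c) = φ (MvPolynomial.X s) := by
    rw [← MvPolynomial.algebraMap_eq, AlgEquiv.commutes, Algebra.algebraMap_eq_smul_one, hc, gen]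
  have h2 := congrArg (MvPolynomial.coeff (Finsupp.single s 1)) (φ.injective h1)
  classical
  rw [MvPolynomial.coeff_X, MvPolynomial.coeff_C, if_neg] at h2
  · exact zero_ne_one (h2.trans (if_pos rfl))
  · exact (Finsupp.single_ne_zero.2 one_ne_zero).symm

/-- The leading part of `g_b` for the filtration by length is the monomial `b`. -/
lemma IsConnectedGraded.g_sub_mem (h𝒜 : IsConnectedGraded 𝒜) (φ : MvPolynomial σ k ≃ₐ[k] H)
    (hgen : ∀ s, SetLike.IsHomogeneousElem 𝒜 (gen φ s)) (b : σ →₀ ℕ) :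
    g φ b - monomialBasis φ b ∈ genIdeal φ ^ (length b + 1) := by
  rw [monomialBasis_apply, g]
  choose d hd hd' using h𝒜.exists_pos_degree φ hgen
  refine (finsuppProd_sub_mem_pow (gen_mem_genIdeal φ) (fun i => ?_) b).2
  refine Ideal.pow_right_mono (ker_counit_le_genIdeal φ fun j => ?_) 2
    (h𝒜.eulerian_sub_mem (hd i) (hd' i))
  exact h𝒜.counit_eq_zero _ (hd j) _ (hd' j)

lemma IsConnectedGraded.repr_g_of_le (h𝒜 : IsConnectedGraded 𝒜) (φ : MvPolynomial σ k ≃ₐ[k] H)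
    (hgen : ∀ s, SetLike.IsHomogeneousElem 𝒜 (gen φ s)) {b b' : σ →₀ ℕ}
    (h : length b' ≤ length b) :
    (monomialBasis φ).repr (g φ b) b' = Finsupp.single b 1 b' := by
  have h1 := repr_eq_zero_of_mem_pow φ (h𝒜.g_sub_mem φ hgen b) (Nat.lt_succ_of_le h)
  rw [map_sub, Module.Basis.repr_self, Finsupp.sub_apply, sub_eq_zero] at h1
  exact h1

/-- Expansion of `g_b` over any set of monomials other than `b` that supports the rest of it. -/
lemma IsConnectedGraded.g_eq_add_finsum (h𝒜 : IsConnectedGraded 𝒜)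
    (φ : MvPolynomial σ k ≃ₐ[k] H) (hgen : ∀ s, SetLike.IsHomogeneousElem 𝒜 (gen φ s))
    (b : σ →₀ ℕ) (p : (σ →₀ ℕ) → Prop) (hp : ¬ p b)
    (h : ∀ b', b' ≠ b → (monomialBasis φ).repr (g φ b) b' ≠ 0 → p b') :
    g φ b = monomialBasis φ b +
      ∑ᶠ (b' : σ →₀ ℕ) (_ : p b'), (monomialBasis φ).repr (g φ b) b' • monomialBasis φ b' := by
  classical
  have hb : (monomialBasis φ).repr (g φ b) b = 1 := by
    rw [h𝒜.repr_g_of_le φ hgen le_rfl, Finsupp.single_eq_same]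
  rw [finsum_cond_eq_sum_of_cond_iff (t := ((monomialBasis φ).repr (g φ b)).support.erase b)]
  · conv_lhs => rw [← (monomialBasis φ).linearCombination_repr (g φ b),
      Finsupp.linearCombination_apply, Finsupp.sum]
    rw [← Finset.add_sum_erase _ _ (a := b) (by
      rw [Finsupp.mem_support_iff, hb]; exact one_ne_zero), hb, one_smul]
  · intro b' hb'
    have h0 : (monomialBasis φ).repr (g φ b) b' ≠ 0 := fun h0 => hb' (by rw [h0, zero_smul])
    rw [Finset.mem_erase, Finsupp.mem_support_iff]
    refine ⟨fun hpb => ⟨?_, h0⟩, fun hne => h b' hne.1 h0⟩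
    rintro rfl
    exact hp hpb

variable [CharZero k]

/-- The coefficient of `b'` in `Ψ^a(b)` is a polynomial in `a`, in which the coefficient of
`a ^ length b` is the coefficient of `b'` in `g_b`. Hence it cannot vanish for all `a ≥ 1` unless
the latter does. -/
lemma IsConnectedGraded.reaches_of_repr_g_ne_zero (h𝒜 : IsConnectedGraded 𝒜)
    (φ : MvPolynomial σ k ≃ₐ[k] H) (hgen : ∀ s, SetLike.IsHomogeneousElem 𝒜 (gen φ s))
    {b b' : σ →₀ ℕ} (h : (monomialBasis φ).repr (g φ b) b' ≠ 0) : Reaches φ b b' := by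
  choose d hd hd' using h𝒜.exists_pos_degree φ hgen
  -- the product of the `P i` interpolates `a ↦ Ψ^a(b)`, by multiplicativity of `Ψ^a`
  choose P hP hP0 hP1 using fun i => h𝒜.exists_powerPolynomial (hd i) (hd' i)
  by_contra hr
  simp only [Reaches, not_exists, not_and, not_not] at hr
  refine h ?_
  have hc := coeff_length_finsuppProd_pow P hP0 b
  simp only [hP1] at hc
  rw [g, ← hc]
  refine map_coeff_eq_zero_of_map_eval_eq_zero ((monomialBasis φ).coord b')
    (b.prod fun i m => P i ^ m) (fun a ha => ?_) (length b)
  have he : (b.prod fun i m => P i ^ m).eval (a : H) = hopfPower k H a (monomialBasis φ b) := by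
    rw [monomialBasis_apply, ← hopfPowerAlgHom_apply ha, Finsupp.prod, Finsupp.prod, map_prod,
      eval_prod]
    refine Finset.prod_congr rfl fun i _ => ?_
    rw [eval_pow, hP i a ha, map_pow, hopfPowerAlgHom_apply ha]
  rw [he]
  exact hr a ha

lemma IsConnectedGraded.hasEigenvector_g (h𝒜 : IsConnectedGraded 𝒜)
    (φ : MvPolynomial σ k ≃ₐ[k] H) (hgen : ∀ s, SetLike.IsHomogeneousElem 𝒜 (gen φ s))
    {a : ℕ} (ha : 1 ≤ a) (b : σ →₀ ℕ) :
    (hopfPower k H a).HasEigenvector ((a : k) ^ length b) (g φ b) := by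
  have : IsDomain H := φ.symm.toMulEquiv.isDomain _
  refine ⟨Module.End.mem_eigenspace_iff.2 ?_, fun h0 => ?_⟩
  · choose d hd hd' using h𝒜.exists_pos_degree φ hgen
    rw [← hopfPowerAlgHom_apply ha, g, Finsupp.prod, map_prod, length, Finsupp.sum,
      ← Finset.prod_pow_eq_pow_sum, ← Finset.prod_smul]
    refine Finset.prod_congr rfl fun i _ => ?_
    rw [map_pow, hopfPowerAlgHom_apply ha, h𝒜.hopfPower_eulerian (hd i) (hd' i) ha, _root_.smul_pow]
  · have h1 := h𝒜.repr_g_of_le φ hgen (le_refl (length b))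
    rw [h0] at h1
    simp at h1

end Generators

/-! ### Eigenspaces of diagonal maps -/

section Eigenspaces

/-- If `T` is diagonal in a finite basis, the dimension of an eigenspace is the number of basis
vectors with that eigenvalue. -/
lemma finrank_eigenspace_of_basis {k V ι : Type*} [Field k] [AddCommGroup V] [Module k V]
    [Finite ι] (T : Module.End k V) (v : Module.Basis ι k V) (μ : ι → k)
    (hv : ∀ i, T (v i) = μ i • v i) (c : k) :
    Module.finrank k (T.eigenspace c) = Nat.card {i // μ i = c} := by
  have : Fintype ι := Fintype.ofFinite ι
  have : Fintype {i // μ i = c} := Fintype.ofFinite _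
  have hrepr : ∀ (x : V) (i : ι), v.repr (T x) i = μ i * v.repr x i := by
    intro x i
    have h : v.coord i ∘ₗ T = μ i • v.coord i := by
      refine v.ext fun j => ?_
      rw [LinearMap.comp_apply, hv]
      by_cases hij : j = i
      · simp [hij]
      · simp [hij]
    exact LinearMap.congr_fun h x
  have hs : T.eigenspace c = Submodule.span k (Set.range fun i : {i // μ i = c} => v i) := by
    have himage : (Set.range fun i : {i // μ i = c} => v i) = v '' {i | μ i = c} := by
      ext x; simp
    ext x
    rw [himage, v.mem_span_image, Module.End.mem_eigenspace_iff]
    constructor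
    · intro hx i hi
      have h := hrepr x i
      rw [hx, map_smul, Finsupp.smul_apply, smul_eq_mul] at h
      exact (mul_right_cancel₀ (Finsupp.mem_support_iff.1 hi) h).symm
    · intro hx
      refine v.ext_elem fun i => ?_
      rw [hrepr, map_smul, Finsupp.smul_apply, smul_eq_mul]
      by_cases hi : v.repr x i = 0
      · rw [hi, mul_zero, mul_zero]
      · rw [show μ i = c from hx (Finsupp.mem_support_iff.2 hi)]
  rw [hs, Nat.card_eq_fintype_card]
  exact finrank_span_eq_card (v.linearIndependent.comp _ Subtype.val_injective)

end Eigenspaces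

/-! ### Bases of the homogeneous components -/

section Degrees

variable {k H σ : Type*} [Field k] [CommRing H] [HopfAlgebra k H]
  {𝒜 : ℕ → Submodule k H} [GradedAlgebra 𝒜]

lemma finsuppProd_mem_weight {d : σ → ℕ} {x : σ → H} (hx : ∀ i, x i ∈ 𝒜 (d i)) (b : σ →₀ ℕ) :
    (b.prod fun i m => x i ^ m) ∈ 𝒜 (Finsupp.weight d b) :=
  SetLike.prod_pow_mem_graded 𝒜 d x b fun i _ => hx i

lemma monomialBasis_mem_iff (φ : MvPolynomial σ k ≃ₐ[k] H) {d : σ → ℕ}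
    (hd : ∀ i, gen φ i ∈ 𝒜 (d i)) (b : σ →₀ ℕ) (n : ℕ) :
    monomialBasis φ b ∈ 𝒜 n ↔ Finsupp.weight d b = n := by
  have h : monomialBasis φ b ∈ 𝒜 (Finsupp.weight d b) := by
    rw [monomialBasis_apply]
    exact finsuppProd_mem_weight hd b
  refine ⟨fun hn => ?_, fun hn => hn ▸ h⟩
  have : Nontrivial H := φ.symm.toEquiv.nontrivial
  exact DirectSum.degree_eq_of_mem_mem 𝒜 h hn ((monomialBasis φ).ne_zero b)

lemma gen_mem_iff (φ : MvPolynomial σ k ≃ₐ[k] H) {d : σ → ℕ}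
    (hd : ∀ i, gen φ i ∈ 𝒜 (d i)) (i : σ) (n : ℕ) : gen φ i ∈ 𝒜 n ↔ d i = n := by
  have h := monomialBasis_mem_iff φ hd (Finsupp.single i 1) n
  have h1 : monomialBasis φ (Finsupp.single i 1) = gen φ i := by
    rw [monomialBasis_apply]
    simp [Finsupp.prod_single_index]
  rwa [h1, Finsupp.weight_single, one_smul] at h

/-- The monomials of degree `n` form a basis of the homogeneous component of degree `n`. -/
lemma exists_basis_monomialsOfDegree (φ : MvPolynomial σ k ≃ₐ[k] H)
    (hgen : ∀ s, SetLike.IsHomogeneousElem 𝒜 (gen φ s)) (n : ℕ) :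
    ∃ v : Module.Basis (monomialsOfDegree φ 𝒜 n) k (𝒜 n), ∀ b, (v b : H) = monomialBasis φ b := by
  choose d hd using hgen
  let w : monomialsOfDegree φ 𝒜 n → 𝒜 n := fun b => ⟨monomialBasis φ b, b.2⟩
  have hli : LinearIndependent k w := by
    refine LinearIndependent.of_comp (𝒜 n).subtype ?_
    exact (monomialBasis φ).linearIndependent.comp _ Subtype.val_injective
  have hspan : ⊤ ≤ Submodule.span k (Set.range w) := by
    rintro ⟨x, hx⟩ -
    have hmem : ∀ y : H, DirectSum.decompose 𝒜 y n ∈ Submodule.span k (Set.range w) := by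
      intro y
      induction (monomialBasis φ).mem_span y using Submodule.span_induction with
      | zero => simp
      | add y z _ _ hy hz =>
        rw [DirectSum.decompose_add, DirectSum.add_apply]
        exact add_mem hy hz
      | smul c y _ hy =>
        rw [DirectSum.decompose_smul, DirectSum.smul_apply]
        exact Submodule.smul_mem _ _ hy
      | mem y hy =>
        obtain ⟨b, rfl⟩ := hy
        by_cases hb : monomialBasis φ b ∈ 𝒜 n
        · refine Submodule.subset_span ⟨⟨b, hb⟩, Subtype.ext ?_⟩
          rw [DirectSum.decompose_of_mem_same 𝒜 hb]
        · have h0 : DirectSum.decompose 𝒜 (monomialBasis φ b) n = 0 := Subtype.ext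
            (DirectSum.decompose_of_mem_ne 𝒜 ((monomialBasis_mem_iff φ hd b _).2 rfl)
              fun h => hb ((monomialBasis_mem_iff φ hd b n).2 h))
          rw [h0]
          exact zero_mem _
    have h := hmem x
    rwa [show DirectSum.decompose 𝒜 x n = ⟨x, hx⟩ from
      Subtype.ext (DirectSum.decompose_of_mem_same 𝒜 hx)] at h
  exact ⟨Module.Basis.mk hli hspan, fun b => by rw [Module.Basis.mk_apply]⟩

lemma IsConnectedGraded.finite_monomialsOfDegree (h𝒜 : IsConnectedGraded 𝒜)
    (φ : MvPolynomial σ k ≃ₐ[k] H) (hgen : ∀ s, SetLike.IsHomogeneousElem 𝒜 (gen φ s)) (n : ℕ) :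
    (monomialsOfDegree φ 𝒜 n).Finite := by
  obtain ⟨v, -⟩ := exists_basis_monomialsOfDegree (𝒜 := 𝒜) φ hgen n
  have := h𝒜.finiteDimensional n
  exact Module.Finite.finite_basis v

/-- Triangularity with respect to length makes the `g_b` linearly independent. -/
lemma IsConnectedGraded.linearIndependent_g (h𝒜 : IsConnectedGraded 𝒜)
    (φ : MvPolynomial σ k ≃ₐ[k] H) (hgen : ∀ s, SetLike.IsHomogeneousElem 𝒜 (gen φ s)) :
    LinearIndependent k (g φ) := by
  rw [linearIndependent_iff]
  intro c hc
  by_contra h0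
  -- a shortest monomial `b` of the relation `c` occurs in no other `g_b'` that enters it
  obtain ⟨b, hb, hmin⟩ := Finset.exists_min_image c.support length
    (Finsupp.support_nonempty_iff.2 h0)
  refine Finsupp.mem_support_iff.1 hb ?_
  have h1 := congrArg (fun x => (monomialBasis φ).coord b x) hc
  simp only [Finsupp.linearCombination_apply, Finsupp.sum, map_sum, map_smul, map_zero,
    Module.Basis.coord_apply, smul_eq_mul] at h1
  rw [← h1, Finset.sum_eq_single_of_mem b hb]
  · rw [h𝒜.repr_g_of_le φ hgen le_rfl, Finsupp.single_eq_same, mul_one]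
  · intro b' hb' hne
    rw [h𝒜.repr_g_of_le φ hgen (hmin b' hb'), Finsupp.single_eq_of_ne hne.symm, mul_zero]

lemma IsConnectedGraded.exists_basis_g (h𝒜 : IsConnectedGraded 𝒜)
    (φ : MvPolynomial σ k ≃ₐ[k] H) (hgen : ∀ s, SetLike.IsHomogeneousElem 𝒜 (gen φ s)) (n : ℕ) :
    ∃ v : Module.Basis (monomialsOfDegree φ 𝒜 n) k (𝒜 n), ∀ b, (v b : H) = g φ b := by
  obtain ⟨u, -⟩ := exists_basis_monomialsOfDegree (𝒜 := 𝒜) φ hgen n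
  have := h𝒜.finiteDimensional n
  have : Fintype (monomialsOfDegree φ 𝒜 n) := (h𝒜.finite_monomialsOfDegree φ hgen n).fintype
  choose d hd using hgen
  have hmem : ∀ b : monomialsOfDegree φ 𝒜 n, g φ b ∈ 𝒜 n := by
    intro b
    have h := finsuppProd_mem_weight (fun i => h𝒜.eulerian_mem (hd i)) (b : σ →₀ ℕ)
    rwa [(monomialBasis_mem_iff φ hd (b : σ →₀ ℕ) n).1 b.2] at h
  have hli : LinearIndependent k (fun b : monomialsOfDegree φ 𝒜 n => (⟨g φ b, hmem b⟩ : 𝒜 n)) := by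
    refine LinearIndependent.of_comp (𝒜 n).subtype ?_
    exact (h𝒜.linearIndependent_g φ fun s => ⟨d s, hd s⟩).comp _ Subtype.val_injective
  refine ⟨basisOfLinearIndependentOfCardEqFinrank' _ hli (Module.finrank_eq_card_basis u).symm,
    fun b => ?_⟩
  rw [coe_basisOfLinearIndependentOfCardEqFinrank']

end Degrees

/-! ### Counting multisets by weight -/

section GeneratingFunction

open MvPowerSeries

variable {σ τ : Type*}

/-- Nonzero weights bound every multiplicity by the degree of the total weight. -/
lemma finite_setOf_weight_eq {m : σ → τ →₀ ℕ} (hm : ∀ s, m s ≠ 0) (T : Finset σ) (e : τ →₀ ℕ) :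
    {b : σ →₀ ℕ | b.support ⊆ T ∧ Finsupp.weight m b = e}.Finite := by
  classical
  refine (Set.finite_Iic (Finsupp.indicator T fun _ _ => e.degree)).subset ?_
  rintro b ⟨hb, rfl⟩ s
  by_cases hs : s ∈ T
  · rw [Finsupp.indicator_of_mem hs]
    have h1 : (Finsupp.weight m b).degree = Finsupp.weight (fun s => (m s).degree) b := by
      simp only [Finsupp.weight_apply, Finsupp.sum, map_sum, map_nsmul]
    rw [h1]
    exact Finsupp.le_weight _ (by rw [Ne, Finsupp.degree_eq_zero_iff]; exact hm s) b
  · rw [Finsupp.notMem_support_iff.1 fun h => hs (hb h)]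
    exact Nat.zero_le _

/-- The power series whose coefficient at `e` is the number of multisets `b` in `σ`, satisfying
`p`, of total weight `e`. -/
def countSeries (m : σ → τ →₀ ℕ) (p : (σ →₀ ℕ) → Prop) : MvPowerSeries τ ℤ :=
  fun e => ({b | p b ∧ Finsupp.weight m b = e}.ncard : ℤ)

lemma coeff_countSeries (m : σ → τ →₀ ℕ) (p : (σ →₀ ℕ) → Prop) (e : τ →₀ ℕ) :
    coeff e (countSeries m p) = ({b | p b ∧ Finsupp.weight m b = e}.ncard : ℤ) := rfl

/-- The recursion on the set of allowed elements behind the product formula for multisets. -/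
lemma countSeries_cons_mul {m : σ → τ →₀ ℕ} (hm : ∀ s, m s ≠ 0) {t : σ} {T : Finset σ}
    (ht : t ∉ T) :
    countSeries m (fun b => b.support ⊆ T.cons t ht) * (1 - monomial (m t) 1) =
      countSeries m (fun b => b.support ⊆ T) := by
  classical
  ext e
  rw [mul_sub, mul_one, map_sub, coeff_mul_monomial, sub_eq_iff_eq_add]
  simp only [coeff_countSeries, mul_one]
  -- the multisets containing `t` are those obtained by adding `t` to another one
  have key : {b : σ →₀ ℕ | b.support ⊆ T.cons t ht ∧ Finsupp.weight m b = e} =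
      {b : σ →₀ ℕ | b.support ⊆ T ∧ Finsupp.weight m b = e} ∪
        (fun b => b + Finsupp.single t 1) ''
          {b : σ →₀ ℕ | b.support ⊆ T.cons t ht ∧ Finsupp.weight m b + m t = e} := by
    ext b
    simp only [Set.mem_ofPred_eq, Set.mem_union, Set.mem_image]
    constructor
    · rintro ⟨hb, he⟩
      by_cases hbt : b t = 0
      · refine Or.inl ⟨fun s hs => ?_, he⟩
        rcases Finset.mem_cons.1 (hb hs) with rfl | h
        · exact absurd hbt (Finsupp.mem_support_iff.1 hs)
        · exact h
      · refine Or.inr ⟨b - Finsupp.single t 1,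
          ⟨fun s hs => hb (Finsupp.support_tsub hs), ?_⟩, Finsupp.sub_add_single_one_cancel hbt⟩
        rw [Finsupp.weight_sub_single_add hbt, he]
    · rintro (⟨hb, he⟩ | ⟨b, ⟨hb, he⟩, rfl⟩)
      · exact ⟨hb.trans (Finset.subset_cons ht), he⟩
      · refine ⟨fun s hs => ?_, by rw [map_add, Finsupp.weight_single, one_smul, he]⟩
        rcases Finset.mem_union.1 (Finsupp.support_add hs) with h | h
        · exact hb h
        · rw [Finset.mem_singleton.1 (Finsupp.support_single_subset h)]
          exact Finset.mem_cons_self t T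
  have hdisj : Disjoint {b : σ →₀ ℕ | b.support ⊆ T ∧ Finsupp.weight m b = e}
      ((fun b => b + Finsupp.single t 1) ''
          {b : σ →₀ ℕ | b.support ⊆ T.cons t ht ∧ Finsupp.weight m b + m t = e}) := by
    rw [Set.disjoint_left]
    rintro _ ⟨hb, -⟩ ⟨b, -, rfl⟩
    exact ht (hb (by simp))
  have hfin := finite_setOf_weight_eq hm (T.cons t ht) e
  rw [key, Set.finite_union] at hfin
  rw [key, Set.ncard_union_eq hdisj hfin.1 hfin.2,
    Set.ncard_image_of_injective _ (add_left_injective _), Nat.cast_add]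
  congr 1
  split_ifs with hle
  · congr 2
    ext b
    refine and_congr_right fun _ => ?_
    exact (eq_tsub_iff_add_eq_of_le hle).symm
  · rw [Nat.cast_eq_zero]
    convert Set.ncard_empty (σ →₀ ℕ)
    refine Set.eq_empty_of_forall_notMem fun b hb => hle ?_
    rw [← hb.2]
    exact le_add_self

/-- The geometric series in several variables: multisets supported on `T` are counted by
`∏ (1 - x^(m t))⁻¹`. -/
lemma prod_invOfUnit_eq_countSeries {m : σ → τ →₀ ℕ} (hm : ∀ s, m s ≠ 0) (T : Finset σ) :
    ∏ t ∈ T, invOfUnit (1 - monomial (m t) (1 : ℤ)) 1 =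
      countSeries m (fun b => b.support ⊆ T) := by
  classical
  induction T using Finset.cons_induction with
  | empty =>
    ext e
    rw [Finset.prod_empty, coeff_countSeries, coeff_one]
    split_ifs with he
    · have : {b : σ →₀ ℕ | b.support ⊆ ∅ ∧ Finsupp.weight m b = e} = {0} := by
        ext b
        simp only [Finset.subset_empty, Finsupp.support_eq_empty, Set.mem_ofPred_eq,
          Set.mem_singleton_iff, and_iff_left_iff_imp]
        rintro rfl
        rw [map_zero, he]
      rw [this, Set.ncard_singleton, Nat.cast_one]
    · have : {b : σ →₀ ℕ | b.support ⊆ ∅ ∧ Finsupp.weight m b = e} = ∅ := by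
        refine Set.eq_empty_of_forall_notMem fun b hb => he ?_
        rw [← hb.2, Finsupp.support_eq_empty.1 (Finset.subset_empty.1 hb.1), map_zero]
      rw [this, Set.ncard_empty, Nat.cast_zero]
  | cons t T ht ih =>
    have hc : constantCoeff (1 - monomial (m t) (1 : ℤ)) = ((1 : ℤˣ) : ℤ) := by
      rw [map_sub, map_one, ← coeff_zero_eq_constantCoeff_apply, coeff_monomial,
        if_neg (hm t).symm, sub_zero, Units.val_one]
    rw [Finset.prod_cons, ih, ← countSeries_cons_mul hm ht, mul_left_comm, mul_comm (invOfUnit _ _),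
      mul_invOfUnit _ _ hc, mul_one]

/-- The exponent of the monomial `x^d y`. -/
def bidegree (d : σ → ℕ) (s : σ) : Fin 2 →₀ ℕ := Finsupp.single 0 (d s) + Finsupp.single 1 1

lemma bidegree_ne_zero (d : σ → ℕ) (s : σ) : bidegree d s ≠ 0 := fun h => by
  simpa [bidegree] using DFunLike.congr_fun h 1

lemma weight_bidegree (d : σ → ℕ) (b : σ →₀ ℕ) :
    Finsupp.weight (bidegree d) b =
      Finsupp.single 0 (Finsupp.weight d b) + Finsupp.single 1 (length b) := by
  induction b using Finsupp.induction_linear with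
  | zero => simp [length]
  | add f g hf hg =>
    have : length (f + g) = length f + length g :=
      Finsupp.sum_add_index' (fun _ => rfl) fun _ _ _ => rfl
    rw [map_add, hf, hg, map_add, this, Finsupp.single_add, Finsupp.single_add]
    abel
  | single s n =>
    have : length (Finsupp.single s n) = n := Finsupp.sum_single_index rfl
    rw [Finsupp.weight_single, Finsupp.weight_single, this, bidegree, smul_add,
      Finsupp.smul_single, Finsupp.smul_single, smul_eq_mul, smul_eq_mul, mul_one]

lemma eulerFactor_eq_prod {d : σ → ℕ} {i : ℕ} (hfin : {s | d s = i}.Finite) :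
    eulerFactor i {s | d s = i}.ncard =
      ∏ t ∈ hfin.toFinset, invOfUnit (1 - monomial (bidegree d t) (1 : ℤ)) 1 := by
  have h : ∀ t ∈ hfin.toFinset, invOfUnit (1 - monomial (bidegree d t) (1 : ℤ)) 1 =
      invOfUnit (1 - X 1 * X 0 ^ i : MvPowerSeries (Fin 2) ℤ) 1 := by
    intro t ht
    have hd : d t = i := hfin.mem_toFinset.1 ht
    rw [X_pow_eq, X_def, monomial_mul_monomial, one_mul, bidegree, hd, add_comm]
  rw [Finset.prod_congr rfl h, Finset.prod_const, eulerFactor, Set.ncard_eq_toFinset_card _ hfin]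

/-- Only the factors with `i ≤ n` affect the coefficients of degree `n` in `x`. -/
lemma hasProd_eulerFactor {d : σ → ℕ} (hd : ∀ s, 0 < d s) (hfin : ∀ i, {s | d s = i}.Finite) :
    HasProd (fun i : ℕ => eulerFactor (i + 1) {s | d s = i + 1}.ncard)
      (countSeries (bidegree d) fun _ => True) := by
  classical
  rw [HasProd, SummationFilter.unconditional_filter, WithPiTopology.tendsto_iff_coeff_tendsto]
  intro e
  refine tendsto_const_nhds.congr' ?_
  filter_upwards [Filter.eventually_ge_atTop (Finset.range (e 0))] with S hS
  have hprod : ∏ i ∈ S, eulerFactor (i + 1) {s | d s = i + 1}.ncard =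
      ∏ t ∈ S.biUnion fun i => (hfin (i + 1)).toFinset,
        invOfUnit (1 - monomial (bidegree d t) (1 : ℤ)) 1 := by
    rw [Finset.prod_biUnion]
    · exact Finset.prod_congr rfl fun i _ => eulerFactor_eq_prod (hfin (i + 1))
    · intro i _ j _ hij
      rw [Function.onFun, Finset.disjoint_left]
      intro s hs hs'
      have h1 : d s = i + 1 := (hfin (i + 1)).mem_toFinset.1 hs
      have h2 : d s = j + 1 := (hfin (j + 1)).mem_toFinset.1 hs'
      omega
  rw [hprod, prod_invOfUnit_eq_countSeries (bidegree_ne_zero d), coeff_countSeries,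
    coeff_countSeries]
  congr 2
  ext b
  refine and_congr_left fun hb => ⟨fun _ s hs => ?_, fun _ => trivial⟩
  have h0 : e 0 = Finsupp.weight d b := by rw [← hb, weight_bidegree]; simp
  have hle : d s ≤ e 0 := by
    rw [h0]
    exact Finsupp.le_weight_of_ne_zero' d (Finsupp.mem_support_iff.1 hs)
  have hpos := hd s
  refine Finset.mem_biUnion.2 ⟨d s - 1, hS (Finset.mem_range.2 (by omega)), ?_⟩
  rw [Set.Finite.mem_toFinset, Set.mem_ofPred_eq]
  omega

end GeneratingFunction

end HopfPower

end

/-! ### Eigenbases and multiplicities -/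

theorem theorem3p7 {k H σ : Type*} [Field k] [CharZero k] [CommRing H] [HopfAlgebra k H]
    (φ : MvPolynomial σ k ≃ₐ[k] H)
    (𝒜 : ℕ → Submodule k H) [GradedAlgebra 𝒜] (h𝒜 : IsConnectedGraded 𝒜)
    (hgen : ∀ s : σ, SetLike.IsHomogeneousElem 𝒜 (gen φ s)) :
    -- `g_b` is an eigenvector of `Ψ^a` of eigenvalue `a^l`
    (∀ a : ℕ, 1 ≤ a → ∀ b : σ →₀ ℕ,
      (hopfPower k H a).HasEigenvector ((a : k) ^ length b) (g φ b)) ∧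
    -- the two triangularity formulas
    (∀ b : σ →₀ ℕ,
      g φ b = monomialBasis φ b +
        ∑ᶠ (b' : σ →₀ ℕ) (_ : Reaches φ b b' ∧ b' ≠ b),
          (monomialBasis φ).repr (g φ b) b' • monomialBasis φ b') ∧
    (∀ b : σ →₀ ℕ,
      g φ b = monomialBasis φ b +
        ∑ᶠ (b' : σ →₀ ℕ) (_ : length b < length b'),
          (monomialBasis φ).repr (g φ b) b' • monomialBasis φ b') ∧
    -- the `g_b` with `b` of degree `n` are an eigenbasis for the action of `Ψ^a` on `H_n`, and the
    -- multiplicities are the coefficients of the infinite product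
    ∃ F : MvPowerSeries (Fin 2) ℤ,
      HasProd (fun i : ℕ => eulerFactor (i + 1) (numGen φ 𝒜 (i + 1))) F ∧
      ∀ a : ℕ, 1 ≤ a → ∀ n : ℕ,
        ∃ hΨ : ∀ x ∈ 𝒜 n, hopfPower k H a x ∈ 𝒜 n,
          (∃ v : Module.Basis (monomialsOfDegree φ 𝒜 n) k (𝒜 n),
            ∀ b : monomialsOfDegree φ 𝒜 n, (v b : H) = g φ b ∧
              Module.End.HasEigenvector ((hopfPower k H a).restrict hΨ)
                ((a : k) ^ length (b : σ →₀ ℕ)) (v b)) ∧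
          (2 ≤ a → ∀ l : ℕ,
            (Module.finrank k (Module.End.eigenspace ((hopfPower k H a).restrict hΨ) ((a : k) ^ l)) : ℤ) =
              MvPowerSeries.coeff (Finsupp.single 0 n + Finsupp.single 1 l) F) := by
  refine ⟨fun a ha b => h𝒜.hasEigenvector_g φ hgen ha b, fun b => ?_, fun b => ?_, ?_⟩
  · exact h𝒜.g_eq_add_finsum φ hgen b _ (fun h => h.2 rfl) fun b' hne h =>
      ⟨h𝒜.reaches_of_repr_g_ne_zero φ hgen h, hne⟩
  · refine h𝒜.g_eq_add_finsum φ hgen b _ (lt_irrefl _) fun b' hne h => ?_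
    by_contra! hle
    rw [h𝒜.repr_g_of_le φ hgen hle, Finsupp.single_eq_of_ne hne] at h
    exact h rfl
  choose d hd hd' using h𝒜.exists_pos_degree φ hgen
  have hset : ∀ i, {s | gen φ s ∈ 𝒜 i} = {s | d s = i} := fun i => by
    ext s
    exact gen_mem_iff φ hd' s i
  have hmon : ∀ n, monomialsOfDegree φ 𝒜 n = {b | Finsupp.weight d b = n} := fun n => by
    ext b
    exact monomialBasis_mem_iff φ hd' b n
  have hfin : ∀ i, {s | d s = i}.Finite := by
    intro i
    have h := h𝒜.finite_monomialsOfDegree φ hgen i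
    rw [hmon] at h
    refine (h.preimage (f := fun s => Finsupp.single s 1)
      (Finsupp.single_left_injective one_ne_zero).injOn).subset fun s hs => ?_
    simpa [Finsupp.weight_single] using hs
  refine ⟨countSeries (bidegree d) fun _ => True, ?_, fun a ha n =>
    ⟨fun x hx => h𝒜.hopfPower_mem hx ha, ?_⟩⟩
  · simp only [numGen, hset]
    exact hasProd_eulerFactor hd hfin
  obtain ⟨v, hv⟩ := h𝒜.exists_basis_g φ hgen n
  have heig : ∀ b : monomialsOfDegree φ 𝒜 n, Module.End.HasEigenvector
      ((hopfPower k H a).restrict fun x hx => h𝒜.hopfPower_mem (n := n) hx ha)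
      ((a : k) ^ length (b : σ →₀ ℕ)) (v b) := by
    intro b
    refine ⟨Module.End.mem_eigenspace_iff.2 (Subtype.ext ?_), v.ne_zero b⟩
    rw [LinearMap.coe_restrict_apply, Submodule.coe_smul, hv]
    exact (h𝒜.hasEigenvector_g φ hgen ha b).apply_eq_smul
  refine ⟨⟨v, fun b => ⟨hv b, heig b⟩⟩, fun ha2 l => ?_⟩
  have : Finite (monomialsOfDegree φ 𝒜 n) := h𝒜.finite_monomialsOfDegree φ hgen n
  rw [finrank_eigenspace_of_basis _ v _ (fun b => (heig b).apply_eq_smul), coeff_countSeries,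
    ← Nat.card_coe_set_eq, Nat.cast_inj]
  -- as `a ≥ 2` and `k` has characteristic zero, the powers of `a` are distinct
  have hpow : ∀ b : σ →₀ ℕ, (a : k) ^ length b = (a : k) ^ l ↔ length b = l := fun b => by
    rw [← Nat.cast_pow, ← Nat.cast_pow, Nat.cast_inj]
    exact (Nat.pow_right_injective ha2).eq_iff
  refine Nat.card_congr ((Equiv.subtypeSubtypeEquivSubtypeInter
    (fun b => b ∈ monomialsOfDegree φ 𝒜 n) fun b => (a : k) ^ length b = (a : k) ^ l).trans
    (Equiv.subtypeEquivRight fun b => ?_))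
  rw [hpow, hmon, Set.mem_ofPred_eq, Set.mem_ofPred_eq, true_and, weight_bidegree]
  constructor
  · rintro ⟨h1, h2⟩
    rw [h1, h2]
  · intro h
    exact ⟨by simpa using DFunLike.congr_fun h 0, by simpa using DFunLike.congr_fun h 1⟩
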